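/- Let $\mathcal F$ be an ordinary differential field of characteristic $0$, and let $u$ be an element of a differential extension field of $\mathcal F$ that is differentially transcendental over $\mathcal F$. For $S$ in such an extension, $\mathcal F\langle S\rangle$ denotes the differential field generated by $S$ over $\mathcal F$, and $\mathcal F\{u\}$, $\mathcal F\{x,y\}$ denote rings of differential polynomials. The order $\mathrm{ord}_z f$ of a differential polynomial $f$ in a differential variable $z$ is the largest $k$ such that $z^{(k)}$ occurs in $f$, and $-\infty$ if there is none. A linear differential rational parametrization is a pair $$\mathcal P(u)=\left(\frac{P_1(u)}{Q_1(u)},\frac{P_2(u)}{Q_2(u)}\right)\in\mathcal F\langle u\rangle^2\setminus\mathcal F^2,$$ where $P_i,Q_i\in\mathcal F\{u\}$ have total degree at most $1$, $Q_i\neq 0$ and $\gcd(P_i,Q_i)=1$ for $i=1,2$. Its orders are $m_i=\mathrm{ord}(P_i/Q_i):=\max\{\mathrm{ord}_uP_i,\mathrm{ord}_uQ_i\}$. It is called proper if $\mathcal F\langle P_1(u)/Q_1(u),P_2(u)/Q_2(u)\rangle=\mathcal F\langle u\rangle$. For differential polynomials $f_1,f_2\in\mathbb D\{u\}$ of degree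 one and of orders $m_1,m_2\ge 0$ over a differential domain $\mathbb D$, the differential resultant $\delta\text{-}\mathrm{Res}_u(f_1,f_2)\in\mathbb D$ is the determinant of the $(m_1+m_2+2)\times(m_1+m_2+2)$ matrix whose rows are the coefficient vectors of $f_1^{(m_2)},\dots,f_1',f_1,f_2^{(m_1)},\dots,f_2',f_2$, in this order, with respect to $u^{(m_1+m_2)},\dots,u',u,1$. Theorem. Let $\mathcal P(u)$ be a proper linear differential rational parametrization with $m_1\ge 0$ and $m_2\ge 0$. Then, with $\mathbb D=\mathcal F\{x,y\}$, the differential resultant $$R(x,y)=\delta\text{-}\mathrm{Res}_u\bigl(xQ_1(u)-P_1(u),\;yQ_2(u)-P_2(u)\bigr)\in\mathcal F\{x,y\}$$ is nonzero, and $\mathrm{ord}_xR=m_2$ and $\mathrm{ord}_yR=m_1$. Moreover, $R$ has degree exactly $1$ in $x^{(m_2)}$ and degree exactly $1$ in $y^{(m_1)}$. -/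

import Mathlib

open scoped Differential

noncomputable section

namespace DiffAlg

/-- The ring `R{y_i : i ∈ ι}` of differential polynomials over `R`: the polynomial ring in the
derivatives `y_i^{(k)}`, where the variable indexed by `(i, k)` stands for `y_i^{(k)}`. -/
abbrev DiffPoly (ι R : Type*) [CommRing R] : Type _ := MvPolynomial (ι × ℕ) R

section Derivation

variable {ι R : Type*} [CommRing R] [Differential R]

/-- Apply the derivation of `R` to every coefficient of a polynomial. -/
def coeffDeriv (p : DiffPoly ι R) : DiffPoly ι R :=
  ∑ m ∈ p.support, MvPolynomial.monomial m ((p.coeff m)′)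

theorem coeff_coeffDeriv (p : DiffPoly ι R) (m : ι × ℕ →₀ ℕ) :
    (coeffDeriv p).coeff m = (p.coeff m)′ := by
  classical
  simp only [coeffDeriv, MvPolynomial.coeff_sum, MvPolynomial.coeff_monomial,
    Finset.sum_ite_eq', MvPolynomial.mem_support_iff]
  split_ifs with h
  · rfl
  · rw [not_not.mp h, map_zero]

theorem coeffDeriv_add (p q : DiffPoly ι R) :
    coeffDeriv (p + q) = coeffDeriv p + coeffDeriv q := by
  ext m
  simp [coeff_coeffDeriv]

theorem coeffDeriv_mul (p q : DiffPoly ι R) :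
    coeffDeriv (p * q) = p * coeffDeriv q + q * coeffDeriv p := by
  classical
  ext m
  rw [coeff_coeffDeriv, mul_comm q, MvPolynomial.coeff_add, MvPolynomial.coeff_mul,
    MvPolynomial.coeff_mul, MvPolynomial.coeff_mul, map_sum, ← Finset.sum_add_distrib]
  refine Finset.sum_congr rfl fun x _ => ?_
  rw [Derivation.leibniz, coeff_coeffDeriv, coeff_coeffDeriv, smul_eq_mul, smul_eq_mul,
    mul_comm (q.coeff x.2)]

/-- The derivation of `R{y_i : i ∈ ι}`: it extends the derivation of `R` and sends
`y_i^{(k)}` to `y_i^{(k+1)}`. -/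
instance instDifferentialDiffPoly : Differential (DiffPoly ι R) where
  deriv := Derivation.mk'
    (AddMonoidHom.toIntLinearMap
      { toFun := fun p => coeffDeriv p +
          MvPolynomial.mkDerivation R
            (fun v : ι × ℕ => (MvPolynomial.X (v.1, v.2 + 1) : DiffPoly ι R)) p
        map_zero' := by simp [coeffDeriv]
        map_add' := fun p q => by rw [coeffDeriv_add, map_add]; abel })
    (fun p q => by
      simp only [AddMonoidHom.coe_toIntLinearMap, AddMonoidHom.coe_mk, ZeroHom.coe_mk,
        coeffDeriv_mul, Derivation.leibniz, smul_eq_mul]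
      ring)

end Derivation

/-- The `n`-th derivative `a^{(n)}`. -/
def iterDeriv {R : Type*} [CommRing R] [Differential R] (n : ℕ) (a : R) : R :=
  (fun b : R => b′)^[n] a

open Classical in
/-- The order `ord_{y_i} f` of a differential polynomial: the largest `k` such that `y_i^{(k)}`
occurs in `f`, and `-∞ = ⊥` if no derivative of `y_i` occurs. -/
def ord {ι R : Type*} [CommRing R] (i : ι) (f : DiffPoly ι R) : WithBot ℕ :=
  (f.vars.filter fun v => v.1 = i).sup fun v => (v.2 : WithBot ℕ)

section Parametrization

variable {F E : Type*} [Field F] [Differential F] [Field E] [Differential E] [Algebra F E]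

/-- The differential subfield `F⟨S⟩` of `E` generated by `S` over `F`. -/
def diffAdjoin (F : Type*) {E : Type*} [Field F] [Field E] [Differential E] [Algebra F E]
    (S : Set E) : IntermediateField F E :=
  IntermediateField.adjoin F {b | ∃ a ∈ S, ∃ k : ℕ, b = iterDeriv k a}

/-- `u` is differentially transcendental over `F`. -/
def IsDiffTranscendental (F : Type*) {E : Type*} [Field F] [Field E] [Differential E]
    [Algebra F E] (u : E) : Prop :=
  AlgebraicIndependent F fun k : ℕ => iterDeriv k u

/-- The value `P(u)` of a differential polynomial `P` in one differential variable. -/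
def diffEval (u : E) (P : DiffPoly Unit F) : E :=
  MvPolynomial.aeval (fun v : Unit × ℕ => iterDeriv v.2 u) P

/-- The order of the fraction `P/Q` in reduced form. -/
def fracOrd (P Q : DiffPoly Unit F) : WithBot ℕ :=
  max (ord () P) (ord () Q)

/-- `(P₁(u)/Q₁(u), P₂(u)/Q₂(u))` is a linear differential rational parametrization: a point of
`F⟨u⟩² \ F²` given by fractions in reduced form whose numerators and denominators have degree
at most one. -/
structure IsLinearDiffRatParam (u : E) (P₁ Q₁ P₂ Q₂ : DiffPoly Unit F) : Prop where
  denom_ne_zero₁ : Q₁ ≠ 0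
  denom_ne_zero₂ : Q₂ ≠ 0
  degree_num₁ : P₁.totalDegree ≤ 1
  degree_denom₁ : Q₁.totalDegree ≤ 1
  degree_num₂ : P₂.totalDegree ≤ 1
  degree_denom₂ : Q₂.totalDegree ≤ 1
  reduced₁ : IsRelPrime P₁ Q₁
  reduced₂ : IsRelPrime P₂ Q₂
  not_both_const : ¬ (diffEval u P₁ / diffEval u Q₁ ∈ (algebraMap F E).range ∧
    diffEval u P₂ / diffEval u Q₂ ∈ (algebraMap F E).range)

/-- The parametrization `(P₁(u)/Q₁(u), P₂(u)/Q₂(u))` is proper: it generates `F⟨u⟩`. -/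
def IsProperParam (u : E) (P₁ Q₁ P₂ Q₂ : DiffPoly Unit F) : Prop :=
  diffAdjoin F {diffEval u P₁ / diffEval u Q₁, diffEval u P₂ / diffEval u Q₂} =
    diffAdjoin F {u}

end Parametrization

section Resultant

variable {D : Type*} [CommRing D] [Differential D]

/-- The differential resultant matrix of linear `f₁, f₂ ∈ D{u}` of orders `m₁, m₂`: the rows are
the coefficient vectors of `f₁^{(m₂)}, …, f₁', f₁, f₂^{(m₁)}, …, f₂', f₂` with respect to
`u^{(m₁+m₂)}, …, u', u, 1`. -/
def diffResultantMatrix (m₁ m₂ : ℕ) (f₁ f₂ : DiffPoly Unit D) :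
    Matrix (Fin (m₁ + m₂ + 2)) (Fin (m₁ + m₂ + 2)) D :=
  Matrix.of fun k c =>
    let p : DiffPoly Unit D :=
      if (k : ℕ) ≤ m₂ then iterDeriv (m₂ - k) f₁ else iterDeriv (m₁ + m₂ + 1 - k) f₂
    if (c : ℕ) ≤ m₁ + m₂ then p.coeff (Finsupp.single ((), m₁ + m₂ - c) 1) else p.coeff 0

/-- The differential resultant `δ-Res_u(f₁, f₂)` of linear differential polynomials in `D{u}`
(meant for `f₁, f₂` of nonnegative order in `u`). -/
def diffResultant (f₁ f₂ : DiffPoly Unit D) : D :=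
  (diffResultantMatrix ((ord () f₁).unbotD 0) ((ord () f₂).unbotD 0) f₁ f₂).det

end Resultant

/-- For `P, Q ∈ F{u}` and `i = 0, 1`, the polynomial `x Q(u) - P(u)`, respectively
`y Q(u) - P(u)`, in `F{x, y}{u}`, where `F{x, y}` is `DiffPoly (Fin 2) F` with `x` the variable
indexed by `0` and `y` the one indexed by `1`. -/
def implicitEq {F : Type*} [Field F] (i : Fin 2) (P Q : DiffPoly Unit F) :
    DiffPoly Unit (DiffPoly (Fin 2) F) :=
  MvPolynomial.C (MvPolynomial.X (i, 0)) * MvPolynomial.map MvPolynomial.C Q -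
    MvPolynomial.map MvPolynomial.C P

end DiffAlg

end

/-
Write `ξ = P₁(u)/Q₁(u)` and `η = P₂(u)/Q₂(u)`. Among the rows of the resultant matrix only the first
one contains `x^{(m₂)}`, with the coefficient vector of `Q₁` as coefficient. So it suffices that the
matrix with this vector as its first row is nonsingular, and this is checked at `x = ξ`, `y = η`.
There the remaining rows are the derivatives of `f = ξ Q₁ - P₁` and `g = η Q₂ - P₂`, which vanish
at `u`, whereas `Q₁(u) ≠ 0`; hence it is enough that the linear parts of the remaining rows are
independent.

The linear parts `α`, `β` of `f`, `g` are operators in `E[∂]` of orders `m₁`, `m₂`. Applied to the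
Kähler differential `du` they give `Q₁(u) dξ` and `Q₂(u) dη`, up to sign, so properness forces the
left ideal generated by `α` and `β` to contain `1`. The quotient `E[∂]/E[∂]β` has dimension `m₂`
and `α` is a cyclic vector in it, hence `∂ʲα` for `j < m₂` are independent modulo `E[∂]β`.

The statement for `y` follows by symmetry.
-/

noncomputable section

namespace DiffAlg

open Polynomial

section Operators

variable {D D' : Type*} [CommRing D] [Differential D] [CommRing D'] [Differential D']

theorem iterDeriv_succ (n : ℕ) (a : D) : iterDeriv (n + 1) a = (iterDeriv n a)′ :=
  Function.iterate_succ_apply' _ _ _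

theorem map_iterDeriv {σ : D →+* D'} (hσ : ∀ a, σ a′ = (σ a)′) (n : ℕ) (a : D) :
    σ (iterDeriv n a) = iterDeriv n (σ a) :=
  Function.Semiconj.iterate_right hσ n a

/-- Left multiplication by `∂` in the ring `D[∂]` of linear differential operators. The operator
`∑ aₖ ∂ᵏ` is encoded by the polynomial `∑ aₖ Xᵏ`; the rule `∂ a = a′ + a ∂` shows in the first
summand. -/
def derivMul : D[X] →+ D[X] :=
  (Differential.mapCoeffs (A := D)).toLinearMap.toAddMonoidHom + AddMonoidHom.mulLeft X

theorem derivMul_apply (p : D[X]) : derivMul p = Differential.mapCoeffs p + X * p :=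
  rfl

theorem coeff_zero_derivMul (p : D[X]) : (derivMul p).coeff 0 = (p.coeff 0)′ := by
  simp [derivMul_apply]

theorem coeff_succ_derivMul (p : D[X]) (k : ℕ) :
    (derivMul p).coeff (k + 1) = (p.coeff (k + 1))′ + p.coeff k := by
  simp [derivMul_apply]

theorem derivMul_smul (a : D) (p : D[X]) : derivMul (a • p) = a′ • p + a • derivMul p := by
  simp only [derivMul_apply, smul_eq_C_mul, Derivation.leibniz, Differential.mapCoeffs_C,
    smul_eq_mul]
  ring

theorem derivMul_X_pow (k : ℕ) : derivMul (X ^ k : D[X]) = X ^ (k + 1) := by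
  simp [derivMul_apply, Derivation.leibniz_pow, pow_succ']

theorem map_derivMul {σ : D →+* D'} (hσ : ∀ a, σ a′ = (σ a)′) (p : D[X]) :
    (derivMul p).map σ = derivMul (p.map σ) := by
  ext k
  cases k <;> simp [coeff_zero_derivMul, coeff_succ_derivMul, hσ]

theorem degree_derivMul (p : D[X]) : (derivMul p).degree = p.degree + 1 := by
  nontriviality D
  rcases eq_or_ne p 0 with rfl | hp
  · simp
  have hX : (X * p).degree = p.degree + 1 := by rw [X_mul, degree_mul_X]
  have hle : (Differential.mapCoeffs p).degree ≤ p.degree := degree_mono fun k hk => by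
    rw [mem_support_iff, Differential.coeff_mapCoeffs] at hk
    exact mem_support_iff.mpr fun h => hk (by rw [h, map_zero])
  have hlt : p.degree < (X * p).degree := by
    rw [hX, degree_eq_natDegree hp]
    exact_mod_cast p.natDegree.lt_succ_self
  rw [derivMul_apply, degree_add_eq_right_of_degree_lt (hle.trans_lt hlt), hX]

theorem degree_iterate_derivMul (p : D[X]) (j : ℕ) :
    (derivMul^[j] p).degree = p.degree + j := by
  induction j with
  | zero => simp
  | succ j ih => rw [Function.iterate_succ_apply', degree_derivMul, ih, add_assoc, Nat.cast_succ]

/-- The value `∑ aₖ u⁽ᵏ⁾` at `u` of the linear differential operator `∑ aₖ ∂ᵏ`. -/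
def applyOp (u : D) : D[X] →ₗ[D] D :=
  Polynomial.lsum fun k => LinearMap.mulRight D (iterDeriv k u)

theorem applyOp_monomial (u : D) (k : ℕ) (a : D) :
    applyOp u (monomial k a) = a * iterDeriv k u := by
  simp [applyOp, Polynomial.lsum_apply]

theorem applyOp_derivMul (u : D) (p : D[X]) : applyOp u (derivMul p) = (applyOp u p)′ := by
  induction p using Polynomial.induction_on' with
  | add p q hp hq => simp only [map_add, hp, hq]
  | monomial k a =>
    rw [derivMul_apply, Differential.mapCoeffs_monomial, X_mul_monomial, map_add,
      applyOp_monomial, applyOp_monomial, applyOp_monomial, Derivation.leibniz, iterDeriv_succ,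
      smul_eq_mul, smul_eq_mul]
    ring

end Operators

section Order

variable {ι D : Type*} [CommRing D] {i : ι} {f : DiffPoly ι D}

theorem ord_le_iff {n : WithBot ℕ} : ord i f ≤ n ↔ ∀ k : ℕ, (i, k) ∈ f.vars → k ≤ n := by
  simp only [ord, Finset.sup_le_iff, Finset.mem_filter, and_imp]
  exact ⟨fun h k hk => h (i, k) hk rfl, fun h v hv hvi => h v.2 (hvi ▸ hv)⟩

end Order

section Linearization

open MvPolynomial (mkDerivation pderiv)

variable {D : Type*} [CommRing D]

/-- The linearization (Fréchet derivative) `∑ₖ (∂f/∂u⁽ᵏ⁾) ∂ᵏ` of a differential polynomial `f` in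
one differential variable `u`, an operator with coefficients in the ring of differential
polynomials. -/
def linearization : Derivation D (DiffPoly Unit D) (DiffPoly Unit D)[X] :=
  mkDerivation D fun v => X ^ v.2

theorem linearization_X (k : ℕ) :
    linearization (MvPolynomial.X ((), k) : DiffPoly Unit D) = X ^ k :=
  MvPolynomial.mkDerivation_X _ _ _

theorem coeff_linearization (f : DiffPoly Unit D) (k : ℕ) :
    (linearization f).coeff k = pderiv ((), k) f := by
  have h : ((Polynomial.lcoeff (DiffPoly Unit D) k).compDer linearization :
      Derivation D (DiffPoly Unit D) (DiffPoly Unit D)) = pderiv ((), k) := by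
    classical
    refine MvPolynomial.derivation_ext fun v => ?_
    obtain ⟨⟨⟩, l⟩ := v
    change (linearization (MvPolynomial.X ((), l))).coeff k = _
    rw [linearization_X, coeff_X_pow, MvPolynomial.pderiv_X, Pi.single_apply]
    simp only [Prod.ext_iff, true_and, eq_comm]
  exact congr($h f)

/-- The linear part of a differential polynomial in one differential variable `u`, with
`∑ aₖ u⁽ᵏ⁾` encoded as the operator `∑ aₖ ∂ᵏ`. -/
def linPart : DiffPoly Unit D →ₗ[D] D[X] where
  toFun f := (linearization f).map MvPolynomial.constantCoeff
  map_add' f g := by rw [map_add, Polynomial.map_add]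
  map_smul' a f := by
    ext k
    simp [coeff_linearization]

theorem linPart_apply (f : DiffPoly Unit D) :
    linPart f = (linearization f).map MvPolynomial.constantCoeff :=
  rfl

theorem coeff_linPart (f : DiffPoly Unit D) (k : ℕ) :
    (linPart f).coeff k = f.coeff (Finsupp.single ((), k) 1) := by
  rw [linPart_apply, coeff_map, coeff_linearization, MvPolynomial.constantCoeff_eq,
    MvPolynomial.coeff_pderiv]
  simp

theorem linPart_map {D' : Type*} [CommRing D'] (σ : D →+* D') (f : DiffPoly Unit D) :
    linPart (f.map σ) = (linPart f).map σ := by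
  ext k
  simp only [coeff_linPart, MvPolynomial.coeff_map, coeff_map]

theorem linPart_C (a : D) : linPart (MvPolynomial.C a : DiffPoly Unit D) = 0 := by
  rw [linPart_apply, MvPolynomial.derivation_C, Polynomial.map_zero]

theorem linPart_monomial_single (k : ℕ) (a : D) :
    linPart (MvPolynomial.monomial (Finsupp.single ((), k) 1) a) = monomial k a := by
  classical
  ext l
  rw [coeff_linPart, MvPolynomial.coeff_monomial, coeff_monomial]
  simp [Finsupp.single_left_inj]

section TotalDegreeLeOne

variable {f : DiffPoly Unit D}

theorem eq_zero_or_exists_single_of_mem_support (hf : f.totalDegree ≤ 1) {m : Unit × ℕ →₀ ℕ}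
    (hm : m ∈ f.support) : m = 0 ∨ ∃ k, m = Finsupp.single ((), k) 1 := by
  have hdeg : m.degree ≤ 1 := (MvPolynomial.le_totalDegree hm).trans hf
  rcases Nat.le_one_iff_eq_zero_or_eq_one.mp hdeg with h | h
  · exact .inl ((Finsupp.degree_eq_zero_iff m).mp h)
  · obtain ⟨⟨⟨⟩, k⟩, rfl⟩ := (Finsupp.sum_eq_one_iff m).mp h
    exact .inr ⟨k, rfl⟩

theorem linearization_eq_map_linPart (hf : f.totalDegree ≤ 1) :
    linearization f = (linPart f).map MvPolynomial.C := by
  classical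
  ext k m
  rw [coeff_linearization, coeff_map, coeff_linPart, MvPolynomial.coeff_pderiv,
    MvPolynomial.coeff_C]
  split_ifs with hm
  · simp [← hm]
  · rw [MvPolynomial.coeff_eq_zero_of_totalDegree_lt, zero_mul]
    have hm' : m.degree ≠ 0 := (Finsupp.degree_eq_zero_iff m).not.mpr (Ne.symm hm)
    change f.totalDegree < (m + Finsupp.single ((), k) 1).degree
    rw [map_add, Finsupp.degree_single]
    lia

theorem ord_eq_degree_linPart (hf : f.totalDegree ≤ 1) : ord () f = (linPart f).degree := by
  classical
  have mem_vars (k : ℕ) : ((), k) ∈ f.vars ↔ (linPart f).coeff k ≠ 0 := by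
    rw [MvPolynomial.mem_vars_iff_mem_support, coeff_linPart]
    constructor
    · rintro ⟨m, hm, hk⟩
      rcases eq_zero_or_exists_single_of_mem_support hf hm with rfl | ⟨l, rfl⟩
      · simp at hk
      · obtain rfl : k = l := by simpa [Finsupp.single_apply, eq_comm] using hk
        exact MvPolynomial.mem_support_iff.mp hm
    · exact fun h => ⟨_, MvPolynomial.mem_support_iff.mpr h, by simp⟩
  refine eq_of_forall_ge_iff fun n => ?_
  rw [ord_le_iff, degree_le_iff_coeff_zero]
  refine forall_congr' fun k => ?_
  rw [mem_vars, ← not_lt, not_imp_not]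

end TotalDegreeLeOne

end Linearization

section Deriv

open MvPolynomial (mkDerivation)

variable {ι D D' : Type*} [CommRing D] [Differential D] [CommRing D'] [Differential D']

theorem deriv_eq (f : DiffPoly ι D) :
    f′ = coeffDeriv f +
      mkDerivation D (fun v => (MvPolynomial.X (v.1, v.2 + 1) : DiffPoly ι D)) f :=
  rfl

theorem deriv_C (a : D) :
    (MvPolynomial.C a : DiffPoly ι D)′ = MvPolynomial.C (Differential.deriv a) := by
  classical
  rw [deriv_eq, MvPolynomial.derivation_C, add_zero]
  ext m
  rw [coeff_coeffDeriv, MvPolynomial.coeff_C, MvPolynomial.coeff_C]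
  split_ifs
  · rfl
  · exact map_zero _

theorem deriv_X (v : ι × ℕ) :
    (MvPolynomial.X v : DiffPoly ι D)′ = MvPolynomial.X (v.1, v.2 + 1) := by
  classical
  rw [deriv_eq, MvPolynomial.mkDerivation_X, add_eq_right]
  ext m
  rw [coeff_coeffDeriv, MvPolynomial.coeff_X, MvPolynomial.coeff_zero]
  split_ifs
  · exact Derivation.map_one_eq_zero _
  · exact map_zero _

theorem map_deriv_of_X {σ : DiffPoly ι D →+* D'}
    (hC : ∀ a : D, σ (MvPolynomial.C (Differential.deriv a)) = (σ (MvPolynomial.C a))′)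
    (hX : ∀ v : ι × ℕ, σ (MvPolynomial.X (v.1, v.2 + 1)) = (σ (MvPolynomial.X v))′)
    (f : DiffPoly ι D) : σ f′ = (σ f)′ := by
  induction f using MvPolynomial.induction_on with
  | C a => rw [deriv_C, hC]
  | add f g hf hg => simp only [map_add, hf, hg]
  | mul_X f v hf =>
    simp only [Derivation.leibniz, deriv_X, map_add, map_mul, hf, hX, smul_eq_mul]

theorem map_deriv {σ : D →+* D'} (hσ : ∀ a, σ a′ = (σ a)′) (f : DiffPoly ι D) :
    MvPolynomial.map σ f′ = (MvPolynomial.map σ f)′ :=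
  map_deriv_of_X (by simp [deriv_C, hσ]) (by simp [deriv_X]) f

theorem constantCoeff_deriv (f : DiffPoly ι D) :
    MvPolynomial.constantCoeff f′ = (MvPolynomial.constantCoeff f)′ :=
  map_deriv_of_X (by simp) (by simp) f

theorem linearization_deriv (f : DiffPoly Unit D) :
    linearization f′ = derivMul (linearization f) := by
  induction f using MvPolynomial.induction_on with
  | C a => rw [deriv_C, MvPolynomial.derivation_C, MvPolynomial.derivation_C, map_zero]
  | add f g hf hg => rw [map_add, map_add, map_add, map_add, hf, hg]
  | mul_X f v hf =>
    obtain ⟨⟨⟩, k⟩ := v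
    rw [Derivation.leibniz, Derivation.leibniz, deriv_X, map_add, smul_eq_mul, smul_eq_mul,
      Derivation.leibniz, Derivation.leibniz, hf, map_add, derivMul_smul, derivMul_smul, deriv_X,
      linearization_X, linearization_X, derivMul_X_pow]
    abel

theorem linPart_deriv (f : DiffPoly Unit D) : linPart f′ = derivMul (linPart f) := by
  rw [linPart_apply, linearization_deriv, map_derivMul constantCoeff_deriv, linPart_apply]

theorem linPart_iterDeriv (j : ℕ) (f : DiffPoly Unit D) :
    linPart (iterDeriv j f) = derivMul^[j] (linPart f) :=
  Function.Semiconj.iterate_right linPart_deriv j f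

end Deriv

section CyclicVector

open Submodule

variable {E V : Type*} [Field E] [Differential E] [AddCommGroup V] [Module E V] {δ : V →+ V}

theorem map_mem_span_of_pseudoLinear (hδ : ∀ (a : E) v, δ (a • v) = a′ • v + a • δ v) {S : Set V}
    (hS : ∀ s ∈ S, δ s ∈ span E S) {v : V} (hv : v ∈ span E S) : δ v ∈ span E S := by
  induction hv using span_induction with
  | mem s hs => exact hS s hs
  | zero => rw [map_zero]; exact zero_mem _
  | add v w _ _ hv hw => rw [map_add]; exact add_mem hv hw
  | smul a v hv ih => rw [hδ]; exact add_mem (smul_mem _ _ hv) (smul_mem _ _ ih)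

theorem linearIndependent_mkQ_iterate_of_le_rank
    (hδ : ∀ (a : E) v, δ (a • v) = a′ • v + a • δ v) {T : Submodule E V} (hT : ∀ t ∈ T, δ t ∈ T)
    {v : V} (hv : ∀ N : Submodule E V, (∀ w ∈ N, δ w ∈ N) → T ≤ N → v ∈ N → N = ⊤) {n : ℕ}
    (hn : n ≤ Module.rank E (V ⧸ T)) :
    LinearIndependent E fun j : Fin n => T.mkQ (δ^[j] v) := by
  induction n with
  | zero => exact linearIndependent_empty_type
  | succ n ih =>
    refine linearIndependent_finSucc'.mpr
      ⟨ih (le_trans (by exact_mod_cast n.le_succ) hn), fun hlast => ?_⟩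
    set N := span E (T ∪ Set.range fun j : Fin n => δ^[j] v) with hN
    have hTN : T ≤ N := fun t ht => subset_span (.inl ht)
    have hmap : N.map T.mkQ = span E (Set.range fun j : Fin n => T.mkQ (δ^[j] v)) := by
      rw [hN, span_union, span_eq, Submodule.map_sup, mkQ_map_self, bot_sup_eq, map_span,
        ← Set.range_comp]
      rfl
    have iterate_mem (j : ℕ) (hj : j ≤ n) : δ^[j] v ∈ N := by
      rcases hj.lt_or_eq with hj | rfl
      · exact subset_span (.inr ⟨⟨j, hj⟩, rfl⟩)
      · rw [← sup_eq_right.mpr hTN, ← comap_map_mkQ, hmap]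
        exact hlast
    have hδN : ∀ w ∈ N, δ w ∈ N := fun w hw => map_mem_span_of_pseudoLinear hδ (by
      rintro _ (ht | ⟨j, rfl⟩)
      · exact hTN (hT _ ht)
      · rw [← Function.iterate_succ_apply' δ]
        exact iterate_mem _ j.is_lt) hw
    rw [hv N hδN hTN (iterate_mem 0 n.zero_le), Submodule.map_top, range_mkQ] at hmap
    have hrank : Module.rank E (V ⧸ T) ≤ n :=
      calc Module.rank E (V ⧸ T)
          = Module.rank E (span E (Set.range fun j : Fin n => T.mkQ (δ^[j] v))) := by
            rw [← hmap, rank_top]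
        _ ≤ n := (rank_span_le _).trans (by
            simpa using Cardinal.mk_range_le_lift (f := fun j : Fin n => T.mkQ (δ^[j] v)))
    exact n.lt_succ_self.not_ge (by exact_mod_cast hn.trans hrank)

end CyclicVector

section LeftIdeal

variable {D : Type*} [CommRing D] [Differential D]

/-- A `D`-submodule of `D[∂]` (encoded as `D[X]`) that is a left ideal, i.e. closed under left
multiplication by `∂`. -/
def IsLeftIdeal (N : Submodule D D[X]) : Prop :=
  ∀ p ∈ N, derivMul p ∈ N

theorem IsLeftIdeal.eq_top_of_one_mem {N : Submodule D D[X]} (hN : IsLeftIdeal N) (h1 : 1 ∈ N) :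
    N = ⊤ := by
  have X_pow_mem (k : ℕ) : (X ^ k : D[X]) ∈ N := by
    induction k with
    | zero => rwa [pow_zero]
    | succ k ih => exact derivMul_X_pow (D := D) k ▸ hN _ ih
  refine eq_top_iff.mpr fun p _ => ?_
  rw [p.as_sum_range_C_mul_X_pow]
  exact sum_mem fun k _ => by rw [← smul_eq_C_mul]; exact N.smul_mem _ (X_pow_mem k)

/-- The operators `α` and `β` generate the unit left ideal of `D[∂]`. -/
def GeneratesUnitIdeal (α β : D[X]) : Prop :=
  ∀ N : Submodule D D[X], IsLeftIdeal N → α ∈ N → β ∈ N → N = ⊤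

end LeftIdeal

section Independence

open Submodule

variable {E : Type*} [Field E] [Differential E]

/-- A basis of `E[∂]`, indexed by the degree, adapted to the left ideal generated by an operator
`β` of degree `m`: the powers `∂ⁱ` for `i < m` followed by the multiples `∂ⁱ β`. -/
def adaptedSequence {m : ℕ} {β : E[X]} (hβ : β.degree = m) : Polynomial.Sequence E where
  elems' i := if i < m then X ^ i else derivMul^[i - m] β
  degree_eq' i := by
    split_ifs with hi
    · exact degree_X_pow i
    · rw [degree_iterate_derivMul, hβ, ← Nat.cast_add, Nat.add_sub_cancel' (not_lt.mp hi)]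

theorem adaptedSequence_add {m : ℕ} {β : E[X]} (hβ : β.degree = m) (j : ℕ) :
    adaptedSequence hβ (m + j) = derivMul^[j] β := by
  simp [adaptedSequence]

theorem le_rank_quotient_span_iterate_derivMul {m : ℕ} {β : E[X]} (hβ : β.degree = m) :
    m ≤ Module.rank E (E[X] ⧸ span E (Set.range fun j => derivMul^[j] β)) := by
  set S := adaptedSequence hβ
  have hS : LinearIndependent E S := S.linearIndependent
  have hspan : span E (Set.range fun j => derivMul^[j] β) ≤ span E (S '' Set.Ici m) := by
    rw [span_le]
    rintro _ ⟨j, rfl⟩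
    exact subset_span ⟨m + j, Nat.le_add_right m j, adaptedSequence_add hβ j⟩
  have hdisj : Disjoint (span E (Set.range fun i : Fin m => S i))
      (span E (Set.range fun j => derivMul^[j] β)) := by
    refine (hS.disjoint_span_image (Set.Iio_disjoint_Ici le_rfl)).mono (span_mono ?_) hspan
    rintro _ ⟨i, rfl⟩
    exact ⟨i, i.is_lt, rfl⟩
  have hli := (hS.comp ((↑) : Fin m → ℕ) Fin.val_injective).map
    (f := (span E (Set.range fun j => derivMul^[j] β)).mkQ) (by rwa [ker_mkQ])
  simpa using hli.cardinal_lift_le_rank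

theorem GeneratesUnitIdeal.linearIndependent_iterate_derivMul {α β : E[X]}
    (hgen : GeneratesUnitIdeal α β) {m : ℕ} (hβ : β.degree = m) :
    LinearIndependent E (Sum.elim (fun j : ℕ => derivMul^[j] β)
      (fun j : Fin m => derivMul^[j] α)) := by
  set T := span E (Set.range fun j => derivMul^[j] β)
  have hT : ∀ t ∈ T, derivMul t ∈ T := fun t => map_mem_span_of_pseudoLinear derivMul_smul (by
    rintro _ ⟨j, rfl⟩
    exact subset_span ⟨j + 1, Function.iterate_succ_apply' _ _ _⟩)
  have hβT (j : ℕ) : derivMul^[j] β ∈ T := subset_span ⟨j, rfl⟩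
  have hβ_indep : LinearIndependent E fun j : ℕ => derivMul^[j] β := by
    simpa only [Function.comp_def, adaptedSequence_add] using
      (adaptedSequence hβ).linearIndependent.comp (m + ·) (add_right_injective m)
  refine LinearIndependent.sumElim_of_quotient (f := fun j : ℕ => (⟨_, hβT j⟩ : T))
    (.of_comp T.subtype hβ_indep) _ ?_
  exact linearIndependent_mkQ_iterate_of_le_rank derivMul_smul hT
    (fun N hN hTN hα => hgen N hN hα (hTN (hβT 0))) (le_rank_quotient_span_iterate_derivMul hβ)

end Independence

section Evaluation

variable {ι F E : Type*} [CommRing F] [CommRing E] [Differential E] [Algebra F E]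

/-- The specialization `yᵢ⁽ᵏ⁾ ↦ ζᵢ⁽ᵏ⁾` of differential polynomials. -/
def specialize (ζ : ι → E) : DiffPoly ι F →ₐ[F] E :=
  MvPolynomial.aeval fun v => iterDeriv v.2 (ζ v.1)

theorem specialize_X (ζ : ι → E) (v : ι × ℕ) :
    specialize ζ (MvPolynomial.X v : DiffPoly ι F) = iterDeriv v.2 (ζ v.1) :=
  MvPolynomial.aeval_X _ _

theorem specialize_C (ζ : ι → E) (a : F) :
    specialize ζ (MvPolynomial.C a : DiffPoly ι F) = algebraMap F E a :=
  MvPolynomial.aeval_C _ _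

theorem specialize_deriv [Differential F] [DifferentialAlgebra F E] (ζ : ι → E)
    (f : DiffPoly ι F) : specialize ζ f′ = (specialize ζ f)′ :=
  map_deriv_of_X (σ := (specialize ζ : DiffPoly ι F →ₐ[F] E).toRingHom)
    (fun a => ((specialize_C ζ _).trans (DifferentialAlgebra.deriv_algebraMap a).symm).trans
      congr(Differential.deriv $(specialize_C ζ a)).symm)
    (fun v => ((specialize_X ζ _).trans (iterDeriv_succ _ _)).trans
      congr(Differential.deriv $(specialize_X ζ v)).symm) f

/-- The value at `u` of the part of degree at most one of a differential polynomial. -/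
def affineValue (u : E) : DiffPoly Unit E →ₗ[E] E :=
  MvPolynomial.lcoeff E 0 + applyOp u ∘ₗ linPart

theorem affineValue_apply (u : E) (f : DiffPoly Unit E) :
    affineValue u f = MvPolynomial.constantCoeff f + applyOp u (linPart f) :=
  rfl

theorem affineValue_deriv (u : E) (f : DiffPoly Unit E) :
    affineValue u f′ = (affineValue u f)′ := by
  rw [affineValue_apply, affineValue_apply, constantCoeff_deriv, linPart_deriv, applyOp_derivMul,
    map_add]

theorem affineValue_map {P : DiffPoly Unit F} (hP : P.totalDegree ≤ 1) (u : E) :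
    affineValue u (P.map (algebraMap F E)) = specialize (fun _ => u) P := by
  classical
  rw [P.as_sum, map_sum, map_sum, map_sum]
  refine Finset.sum_congr rfl fun m hm => ?_
  rcases eq_zero_or_exists_single_of_mem_support hP hm with rfl | ⟨k, rfl⟩
  · rw [MvPolynomial.monomial_zero', MvPolynomial.map_C, specialize_C, affineValue_apply,
      MvPolynomial.constantCoeff_C, linPart_C, map_zero, add_zero]
  · rw [MvPolynomial.map_monomial, affineValue_apply, linPart_monomial_single, applyOp_monomial,
      MvPolynomial.constantCoeff_monomial, if_neg (by simp), zero_add,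
      ← MvPolynomial.C_mul_X_eq_monomial, map_mul, specialize_C, specialize_X]

end Evaluation

section Differentials

variable {F E : Type*} [Field F] [Field E] [Differential E] [Algebra F E]

/-- The differential `dP = ∑ₖ (∂P/∂u⁽ᵏ⁾)(u) du⁽ᵏ⁾` of `P` at `u`, where `du⁽ᵏ⁾ = ∂ᵏ du` is encoded
by `Xᵏ`. -/
def differentialAt (u : E) : DiffPoly Unit F →ₗ[F] E[X] :=
  (Polynomial.mapAlgHom (specialize fun _ => u)).toLinearMap ∘ₗ linearization.toLinearMap

theorem differentialAt_apply (u : E) (P : DiffPoly Unit F) :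
    differentialAt u P = (linearization P).map (specialize fun _ => u).toRingHom :=
  rfl

theorem differentialAt_mul (u : E) (P Q : DiffPoly Unit F) :
    differentialAt u (P * Q) =
      specialize (fun _ => u) P • differentialAt u Q +
        specialize (fun _ => u) Q • differentialAt u P := by
  simp only [differentialAt_apply, Derivation.leibniz, Polynomial.map_add, Polynomial.map_smul]
  rfl

theorem differentialAt_C (u : E) (a : F) :
    differentialAt u (MvPolynomial.C a : DiffPoly Unit F) = 0 := by
  rw [differentialAt_apply, MvPolynomial.derivation_C, Polynomial.map_zero]

theorem differentialAt_X_zero (u : E) :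
    differentialAt u (MvPolynomial.X ((), 0) : DiffPoly Unit F) = 1 := by
  rw [differentialAt_apply, linearization_X, pow_zero, Polynomial.map_one]

theorem differentialAt_deriv [Differential F] [DifferentialAlgebra F E] (u : E)
    (P : DiffPoly Unit F) : differentialAt u P′ = derivMul (differentialAt u P) := by
  rw [differentialAt_apply, linearization_deriv, map_derivMul (specialize_deriv _),
    differentialAt_apply]

theorem differentialAt_eq_map_linPart (u : E) {P : DiffPoly Unit F} (hP : P.totalDegree ≤ 1) :
    differentialAt u P = (linPart P).map (algebraMap F E) := by
  rw [differentialAt_apply, linearization_eq_map_linPart hP, Polynomial.map_map]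
  congr 1
  ext a
  exact specialize_C (fun _ : Unit => u) a

end Differentials

section Generation

variable {F E : Type*} [Field F] [Field E] [Differential E] [Algebra F E] {u : E}
  {N : Submodule E E[X]}

variable (F u N) in
/-- `z` is a fraction `A(u)/B(u)` whose differential lies in `N`; the condition is cleared of
denominators, since `B(u) dz = dA - z dB`. -/
def DifferentialMem (z : E) : Prop :=
  ∃ A B : DiffPoly Unit F, specialize (fun _ => u) B ≠ 0 ∧
    specialize (fun _ => u) A = z * specialize (fun _ => u) B ∧
    z • differentialAt u B - differentialAt u A ∈ N

namespace DifferentialMem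

theorem of_algebraMap (a : F) : DifferentialMem F u N (algebraMap F E a) :=
  ⟨MvPolynomial.C a, MvPolynomial.C 1, by simp, by simp, by
    simp only [differentialAt_C, smul_zero, sub_zero, zero_mem]⟩

theorem add {z w : E} (hz : DifferentialMem F u N z) (hw : DifferentialMem F u N w) :
    DifferentialMem F u N (z + w) := by
  obtain ⟨A, B, hB, hA, hz⟩ := hz
  obtain ⟨A', B', hB', hA', hw⟩ := hw
  refine ⟨A * B' + A' * B, B * B', ?_, ?_, ?_⟩
  · rw [map_mul]
    exact mul_ne_zero hB hB'
  · simp only [map_add, map_mul, hA, hA']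
    ring
  · convert add_mem (N.smul_mem (specialize (fun _ => u) B) hw)
      (N.smul_mem (specialize (fun _ => u) B') hz) using 1
    simp only [map_add, differentialAt_mul, hA, hA']
    module

theorem mul {z w : E} (hz : DifferentialMem F u N z) (hw : DifferentialMem F u N w) :
    DifferentialMem F u N (z * w) := by
  obtain ⟨A, B, hB, hA, hz⟩ := hz
  obtain ⟨A', B', hB', hA', hw⟩ := hw
  refine ⟨A * A', B * B', ?_, ?_, ?_⟩
  · rw [map_mul]
    exact mul_ne_zero hB hB'
  · simp only [map_mul, hA, hA']
    ring
  · convert add_mem (N.smul_mem (z * specialize (fun _ => u) B) hw)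
      (N.smul_mem (w * specialize (fun _ => u) B') hz) using 1
    simp only [differentialAt_mul, hA, hA']
    module

theorem inv {z : E} (hz : DifferentialMem F u N z) : DifferentialMem F u N z⁻¹ := by
  rcases eq_or_ne z 0 with rfl | hz0
  · rwa [inv_zero]
  obtain ⟨A, B, hB, hA, hz⟩ := hz
  refine ⟨B, A, hA ▸ mul_ne_zero hz0 hB, by rw [hA, inv_mul_cancel_left₀ hz0], ?_⟩
  convert N.smul_mem (-z⁻¹) hz using 1
  rw [smul_sub, smul_smul, neg_mul, inv_mul_cancel₀ hz0]
  module

theorem deriv [Differential F] [DifferentialAlgebra F E] (hN : IsLeftIdeal N) {z : E}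
    (hz : DifferentialMem F u N z) : DifferentialMem F u N z′ := by
  obtain ⟨A, B, hB, hA, hz⟩ := hz
  have hA' : (specialize (fun _ => u) A)′ =
      z * (specialize (fun _ => u) B)′ + specialize (fun _ => u) B * z′ := by
    rw [hA, Derivation.leibniz, smul_eq_mul, smul_eq_mul]
  refine ⟨A′ * B - A * B′, B * B, ?_, ?_, ?_⟩
  · rw [map_mul]
    exact mul_ne_zero hB hB
  · rw [map_sub, map_mul, map_mul, map_mul, specialize_deriv, specialize_deriv, hA', hA]
    ring
  · convert sub_mem (N.smul_mem (specialize (fun _ => u) B) (hN _ hz))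
      (N.smul_mem (specialize (fun _ => u) B)′ hz) using 1
    simp only [map_sub, differentialAt_mul, derivMul_smul, differentialAt_deriv, specialize_deriv,
      hA, Derivation.leibniz, smul_eq_mul]
    module

end DifferentialMem

variable (F u N) in
/-- The intermediate field of the fractions `A(u)/B(u)` whose differential lies in `N`. -/
def differentialMemField : IntermediateField F E where
  carrier := {z | DifferentialMem F u N z}
  mul_mem' := DifferentialMem.mul
  add_mem' := DifferentialMem.add
  algebraMap_mem' := DifferentialMem.of_algebraMap
  inv_mem' _ := DifferentialMem.inv

theorem specialize_injective (hu : IsDiffTranscendental F u) :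
    Function.Injective (specialize fun _ => u : DiffPoly Unit F →ₐ[F] E) :=
  hu.comp (fun v : Unit × ℕ => v.2) fun _ _ h => Prod.ext rfl h

theorem diffAdjoin_le {S : Set E} {K : IntermediateField F E} (hSK : S ⊆ K)
    (hK : ∀ z ∈ K, z′ ∈ K) : diffAdjoin F S ≤ K := by
  refine IntermediateField.adjoin_le_iff.mpr ?_
  rintro _ ⟨a, ha, k, rfl⟩
  induction k with
  | zero => exact hSK ha
  | succ k ih => rw [iterDeriv_succ]; exact hK _ ih

theorem eq_top_of_differentialMem (hu : IsDiffTranscendental F u) (hN : IsLeftIdeal N)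
    (h : DifferentialMem F u N u) : N = ⊤ := by
  obtain ⟨A, B, hB, hA, h⟩ := h
  have hAB : A = MvPolynomial.X ((), 0) * B := specialize_injective hu <| by
    rw [map_mul, specialize_X, hA]
    rfl
  refine hN.eq_top_of_one_mem ((N.smul_mem_iff (neg_ne_zero.mpr hB)).mp ?_)
  convert h using 1
  rw [hAB, differentialAt_mul, differentialAt_X_zero, specialize_X]
  change _ = u • _ - (u • _ + _)
  module

theorem generatesUnitIdeal_of_isProperParam [Differential F] [DifferentialAlgebra F E]
    (hu : IsDiffTranscendental F u)
    {P₁ Q₁ P₂ Q₂ : DiffPoly Unit F} (hproper : IsProperParam u P₁ Q₁ P₂ Q₂)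
    (hQ₁ : diffEval u Q₁ ≠ 0) (hQ₂ : diffEval u Q₂ ≠ 0) :
    GeneratesUnitIdeal
      ((diffEval u P₁ / diffEval u Q₁) • differentialAt u Q₁ - differentialAt u P₁)
      ((diffEval u P₂ / diffEval u Q₂) • differentialAt u Q₂ - differentialAt u P₂) := by
  intro N hN h₁ h₂
  have hle : diffAdjoin F {diffEval u P₁ / diffEval u Q₁, diffEval u P₂ / diffEval u Q₂} ≤
      differentialMemField F u N := by
    refine diffAdjoin_le ?_ fun z hz => DifferentialMem.deriv hN hz
    rintro _ (rfl | rfl)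
    · exact ⟨P₁, Q₁, hQ₁, (div_mul_cancel₀ _ hQ₁).symm, h₁⟩
    · exact ⟨P₂, Q₂, hQ₂, (div_mul_cancel₀ _ hQ₂).symm, h₂⟩
  refine eq_top_of_differentialMem hu hN (hle (hproper.symm ▸ ?_))
  exact IntermediateField.subset_adjoin F _ ⟨u, rfl, 0, rfl⟩

end Generation

section ResultantMatrix

variable {D D' : Type*} [CommRing D] [CommRing D']

/-- The coefficient vector of a linear differential polynomial of order at most `N` with respect to
`u⁽ᴺ⁾, …, u′, u, 1`. -/
def coeffRow (N : ℕ) : DiffPoly Unit D →ₗ[D] Fin (N + 2) → D :=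
  LinearMap.pi fun c => if (c : ℕ) ≤ N then Polynomial.lcoeff D (N - c) ∘ₗ linPart
    else MvPolynomial.lcoeff D 0

theorem coeffRow_apply (N : ℕ) (f : DiffPoly Unit D) (c : Fin (N + 2)) :
    coeffRow N f c =
      if (c : ℕ) ≤ N then (linPart f).coeff (N - c) else MvPolynomial.constantCoeff f := by
  rw [coeffRow, LinearMap.pi_apply]
  split_ifs <;> rfl

theorem coeffRow_map (σ : D →+* D') (N : ℕ) (f : DiffPoly Unit D) (c : Fin (N + 2)) :
    coeffRow N (f.map σ) c = σ (coeffRow N f c) := by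
  rw [coeffRow_apply, coeffRow_apply, linPart_map, coeff_map, MvPolynomial.constantCoeff_map,
    apply_ite σ]

theorem linPart_eq_zero_of_coeffRow_eq_zero {N : ℕ} {f : DiffPoly Unit D}
    (hN : (linPart f).degree ≤ N) (hf : coeffRow N f = 0) : linPart f = 0 := by
  ext k
  rcases lt_or_ge N k with hk | hk
  · exact coeff_eq_zero_of_degree_lt (hN.trans_lt (by exact_mod_cast hk))
  · simpa [coeffRow_apply, Nat.sub_sub_self hk] using congrFun hf ⟨N - k, by lia⟩

theorem constantCoeff_eq_zero_of_coeffRow_eq_zero {N : ℕ} {f : DiffPoly Unit D}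
    (hf : coeffRow N f = 0) : MvPolynomial.constantCoeff f = 0 := by
  simpa [coeffRow_apply] using congrFun hf (Fin.last (N + 1))

variable [Differential D] [Differential D']

/-- The sequence `f⁽ⁿ⁾, …, f′, f, g⁽ᵐ⁾, …, g′, g` of the polynomials whose coefficient vectors are
the rows of the differential resultant matrix of `f` and `g`. -/
def prolongation (m n : ℕ) (f g : DiffPoly Unit D) (k : ℕ) : DiffPoly Unit D :=
  if k ≤ n then iterDeriv (n - k) f else iterDeriv (m + n + 1 - k) g

theorem prolongation_map {σ : D →+* D'} (hσ : ∀ a, σ a′ = (σ a)′) (m n : ℕ)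
    (f g : DiffPoly Unit D) (k : ℕ) :
    prolongation m n (f.map σ) (g.map σ) k = (prolongation m n f g k).map σ := by
  rw [prolongation, prolongation, apply_ite (MvPolynomial.map σ), map_iterDeriv (map_deriv hσ),
    map_iterDeriv (map_deriv hσ)]

theorem diffResultantMatrix_apply (m n : ℕ) (f g : DiffPoly Unit D) (k : Fin (m + n + 2)) :
    diffResultantMatrix m n f g k = coeffRow (m + n) (prolongation m n f g k) := by
  ext c
  simp only [diffResultantMatrix, Matrix.of_apply, coeffRow_apply, coeff_linPart,
    MvPolynomial.constantCoeff_eq, prolongation]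

theorem diffResultantMatrix_map {σ : D →+* D'} (hσ : ∀ a, σ a′ = (σ a)′) (m n : ℕ)
    (f g : DiffPoly Unit D) :
    diffResultantMatrix m n (f.map σ) (g.map σ) = (diffResultantMatrix m n f g).map σ := by
  ext k c
  rw [Matrix.map_apply, diffResultantMatrix_apply, diffResultantMatrix_apply, prolongation_map hσ,
    coeffRow_map]

theorem prolongation_swap {m n k : ℕ} (f g : DiffPoly Unit D) (hk : k < m + n + 2) :
    prolongation m n f g (if k < m + 1 then k + (n + 1) else k - (m + 1)) =
      prolongation n m g f k := by
  rcases lt_or_ge k (m + 1) with h | h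
  · rw [if_pos h, prolongation, prolongation, if_neg (by lia), if_pos (by lia)]
    congr 1
    lia
  · rw [if_neg (by lia), prolongation, prolongation, if_pos (by lia), if_neg (by lia)]
    congr 1
    lia

theorem det_diffResultantMatrix_swap (m n : ℕ) (f g : DiffPoly Unit D) :
    (diffResultantMatrix n m g f).det = (diffResultantMatrix m n f g).det ∨
      (diffResultantMatrix n m g f).det = -(diffResultantMatrix m n f g).det := by
  let e : Fin (n + m + 2) ≃ Fin (m + n + 2) := finCongr (by lia)
  let ρ : Fin (n + m + 2) ≃ Fin (m + n + 2) :=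
    (finCongr (show n + m + 2 = (m + 1) + (n + 1) by lia)).trans
      (finAddFlip.trans (finCongr (by lia)))
  have hρ (k : Fin (n + m + 2)) :
      (ρ k : ℕ) = if (k : ℕ) < m + 1 then (k : ℕ) + (n + 1) else k - (m + 1) := by
    split_ifs with h
    · exact (congrArg Fin.val (finAddFlip_apply_mk_left h)).trans (add_comm _ _)
    · exact congrArg Fin.val (finAddFlip_apply_mk_right (not_lt.mp h) (by lia))
  have hrows : diffResultantMatrix n m g f =
      ((diffResultantMatrix m n f g).submatrix e e).submatrix (ρ.trans e.symm) id := by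
    ext k c
    simp only [Matrix.submatrix_apply, Equiv.trans_apply, Equiv.apply_symm_apply, id,
      diffResultantMatrix_apply, hρ, prolongation_swap f g (by lia : (k : ℕ) < m + n + 2),
      coeffRow_apply, e, finCongr_apply, Fin.val_cast, add_comm n m]
  rw [hrows, Matrix.det_permute, Matrix.det_submatrix_equiv_self]
  rcases Int.units_eq_one_or (Equiv.Perm.sign (ρ.trans e.symm)) with h | h <;> simp [h]

theorem diffResultant_swap (f g : DiffPoly Unit D) :
    diffResultant g f = diffResultant f g ∨ diffResultant g f = -diffResultant f g :=
  det_diffResultantMatrix_swap _ _ f g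

end ResultantMatrix

section Nonsingular

variable {E : Type*} [Field E] [Differential E] {u : E}

theorem det_coeffRow_ne_zero {N : ℕ} {f : Fin (N + 2) → DiffPoly Unit E}
    (hdeg : ∀ k, (linPart (f k)).degree ≤ N) (hhead : affineValue u (f 0) ≠ 0)
    (htail : ∀ k : Fin (N + 1), affineValue u (f k.succ) = 0)
    (hli : LinearIndependent E fun k : Fin (N + 1) => linPart (f k.succ)) :
    (Matrix.of fun k => coeffRow N (f k)).det ≠ 0 := by
  rw [← isUnit_iff_ne_zero, ← Matrix.isUnit_iff_isUnit_det,
    ← Matrix.linearIndependent_rows_iff_isUnit, Fintype.linearIndependent_iff]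
  intro c hc
  have hrow : coeffRow N (∑ k, c k • f k) = 0 := by
    rw [map_sum, ← hc]
    exact Finset.sum_congr rfl fun k _ => map_smul _ _ _
  have hlin : linPart (∑ k, c k • f k) = 0 := by
    refine linPart_eq_zero_of_coeffRow_eq_zero ?_ hrow
    rw [map_sum, ← mem_degreeLE]
    exact sum_mem fun k _ => by
      rw [map_smul]; exact Submodule.smul_mem _ _ (mem_degreeLE.mpr (hdeg k))
  have hvalue : affineValue u (∑ k, c k • f k) = 0 := by
    rw [affineValue_apply, hlin, constantCoeff_eq_zero_of_coeffRow_eq_zero hrow, map_zero, add_zero]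
  have hc0 : c 0 = 0 := by
    rw [Fin.sum_univ_succ] at hvalue
    simpa [htail, hhead] using hvalue
  have htail0 : ∑ k : Fin (N + 1), c k.succ • linPart (f k.succ) = 0 := by
    rw [Fin.sum_univ_succ] at hlin
    simpa [hc0] using hlin
  exact Fin.cases hc0 (Fintype.linearIndependent_iff.mp hli _ htail0)

theorem affineValue_iterDeriv_eq_zero {f : DiffPoly Unit E} (hf : affineValue u f = 0) (j : ℕ) :
    affineValue u (iterDeriv j f) = 0 := by
  induction j with
  | zero => exact hf
  | succ j ih => rw [iterDeriv_succ, affineValue_deriv, ih, map_zero]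

theorem degree_linPart_prolongation_le {m n : ℕ} {f g : DiffPoly Unit E}
    (hf : (linPart f).degree ≤ m) (hg : (linPart g).degree ≤ n) (k : ℕ) :
    (linPart (prolongation m n f g k)).degree ≤ ↑(m + n) := by
  rw [prolongation]
  split_ifs with hk <;> rw [linPart_iterDeriv, degree_iterate_derivMul]
  · calc _ ≤ (m : WithBot ℕ) + (n - k : ℕ) := by gcongr
      _ ≤ ↑(m + n) := by norm_cast; lia
  · calc _ ≤ (n : WithBot ℕ) + (m + n + 1 - k : ℕ) := by gcongr
      _ ≤ ↑(m + n) := by norm_cast; lia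

theorem GeneratesUnitIdeal.linearIndependent_linPart_prolongation {m n : ℕ}
    {f g : DiffPoly Unit E} (hgen : GeneratesUnitIdeal (linPart f) (linPart g))
    (hg : (linPart g).degree = n) :
    LinearIndependent E fun k : Fin (m + n + 1) => linPart (prolongation m n f g (k + 1)) := by
  let index (k : Fin (m + n + 1)) : ℕ ⊕ Fin n :=
    if hk : (k : ℕ) < n then .inr ⟨n - (k + 1), by lia⟩ else .inl (m + n - k)
  have index_injective : Function.Injective index := by
    intro k l hkl
    dsimp only [index] at hkl
    split_ifs at hkl <;> simp only [Sum.inr.injEq, Sum.inl.injEq, Fin.mk.injEq] at hkl <;> lia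
  convert (hgen.linearIndependent_iterate_derivMul hg).comp index index_injective using 2 with k
  simp only [Function.comp_apply, index, prolongation]
  split_ifs <;> first | lia | simp [linPart_iterDeriv]

theorem GeneratesUnitIdeal.det_updateRow_diffResultantMatrix_ne_zero {m n : ℕ}
    {f g h : DiffPoly Unit E} (hgen : GeneratesUnitIdeal (linPart f) (linPart g))
    (hf : (linPart f).degree ≤ m) (hg : (linPart g).degree = n)
    (hfu : affineValue u f = 0) (hgu : affineValue u g = 0)
    (hh : (linPart h).degree ≤ m) (hhu : affineValue u h ≠ 0) :
    ((diffResultantMatrix m n f g).updateRow 0 (coeffRow (m + n) h)).det ≠ 0 := by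
  let rows : Fin (m + n + 2) → DiffPoly Unit E :=
    Fin.cons h fun k => prolongation m n f g (k + 1)
  have hrows : (diffResultantMatrix m n f g).updateRow 0 (coeffRow (m + n) h) =
      Matrix.of fun k => coeffRow (m + n) (rows k) := by
    funext k
    cases k using Fin.cases with
    | zero => exact Matrix.updateRow_self
    | succ k => exact (Matrix.updateRow_ne k.succ_ne_zero).trans (diffResultantMatrix_apply ..)
  rw [hrows]
  refine det_coeffRow_ne_zero (u := u) (fun k => ?_) hhu (fun k => ?_)
    (hgen.linearIndependent_linPart_prolongation hg)
  · cases k using Fin.cases with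
    | zero => exact hh.trans (by norm_cast; lia)
    | succ k => exact degree_linPart_prolongation_le hf hg.le _
  · change affineValue u (prolongation m n f g (k + 1)) = 0
    rw [prolongation, apply_ite (affineValue u), affineValue_iterDeriv_eq_zero hfu,
      affineValue_iterDeriv_eq_zero hgu, ite_self]

end Nonsingular

section Degree

variable {τ K : Type*} [CommRing K] {s : Set τ} {v : τ}

theorem degreeOf_eq_zero_of_mem_supported (hv : v ∉ s) {p : MvPolynomial τ K}
    (hp : p ∈ MvPolynomial.supported K s) : p.degreeOf v = 0 :=
  not_ne_iff.mp fun h => hv <|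
    MvPolynomial.mem_supported.mp hp (MvPolynomial.mem_vars_iff_degreeOf_ne_zero.mpr h)

theorem degreeOf_X_mul_add (hv : v ∉ s) {p q : MvPolynomial τ K}
    (hp : p ∈ MvPolynomial.supported K s) (hq : q ∈ MvPolynomial.supported K s) (hp0 : p ≠ 0) :
    (MvPolynomial.X v * p + q).degreeOf v = 1 := by
  have h1 : (MvPolynomial.X v * p).degreeOf v = 1 := by
    rw [mul_comm, (MvPolynomial.degreeOf_mul_X_eq_degreeOf_add_one_iff v p).mpr hp0,
      degreeOf_eq_zero_of_mem_supported hv hp]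
  rw [MvPolynomial.degreeOf_add_eq_of_degreeOf_lt, h1]
  rw [h1, degreeOf_eq_zero_of_mem_supported hv hq]
  exact one_pos

variable {n : Type*} [Fintype n] [DecidableEq n]

theorem det_mem_of_forall_mem {A : Type*} [CommRing A] [Algebra K A] {S : Subalgebra K A}
    {M : Matrix n n A} (hM : ∀ k c, M k c ∈ S) : M.det ∈ S := by
  rw [show M = S.val.mapMatrix (Matrix.of fun k c => ⟨M k c, hM k c⟩) from rfl, ← AlgHom.map_det]
  exact Subtype.property _

theorem degreeOf_det_and_mem_supported (hv : v ∉ s) {M : Matrix n n (MvPolynomial τ K)} {k₀ : n}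
    {r t : n → MvPolynomial τ K} (hk₀ : M k₀ = (MvPolynomial.X v : MvPolynomial τ K) • r + t)
    (hr : ∀ c, r c ∈ MvPolynomial.supported K s) (ht : ∀ c, t c ∈ MvPolynomial.supported K s)
    (hM : ∀ k ≠ k₀, ∀ c, M k c ∈ MvPolynomial.supported K s)
    (hdet : (M.updateRow k₀ r).det ≠ 0) :
    M.det.degreeOf v = 1 ∧ M.det ∈ MvPolynomial.supported K (insert v s) := by
  have det_updateRow_mem {w : n → MvPolynomial τ K}
      (hw : ∀ c, w c ∈ MvPolynomial.supported K s) :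
      (M.updateRow k₀ w).det ∈ MvPolynomial.supported K s := by
    refine det_mem_of_forall_mem fun k c => ?_
    rcases eq_or_ne k k₀ with rfl | hk
    · simpa only [Matrix.updateRow_self] using hw c
    · simpa only [Matrix.updateRow_ne hk] using hM k hk c
  have hdet_eq : M.det =
      MvPolynomial.X v * (M.updateRow k₀ r).det + (M.updateRow k₀ t).det := by
    rw [← Matrix.det_updateRow_smul, ← Matrix.det_updateRow_add, ← hk₀, Matrix.updateRow_eq_self]
  have hle : MvPolynomial.supported K s ≤ MvPolynomial.supported K (insert v s) :=
    MvPolynomial.supported_mono (Set.subset_insert v s)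
  rw [hdet_eq]
  exact ⟨degreeOf_X_mul_add hv (det_updateRow_mem hr) (det_updateRow_mem ht) hdet,
    add_mem (mul_mem (Algebra.subset_adjoin ⟨v, Set.mem_insert v s, rfl⟩)
      (hle (det_updateRow_mem hr))) (hle (det_updateRow_mem ht))⟩

theorem ord_eq_of_degreeOf {ι : Type*} {i : ι} {m : ℕ} {f : DiffPoly ι K}
    (hdeg : f.degreeOf (i, m) ≠ 0)
    (hf : f ∈ MvPolynomial.supported K (insert (i, m) {v : ι × ℕ | v.1 = i → v.2 < m})) :
    ord i f = m := by
  refine le_antisymm (ord_le_iff.mpr fun k hk => ?_)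
    (ord_le_iff.mp le_rfl m (MvPolynomial.mem_vars_iff_degreeOf_ne_zero.mpr hdeg))
  rcases MvPolynomial.mem_supported.mp hf hk with h | h
  · exact_mod_cast (congrArg Prod.snd h).le
  · exact_mod_cast (h rfl).le

theorem ord_neg {ι : Type*} (i : ι) (f : DiffPoly ι K) : ord i (-f) = ord i f := by
  rw [ord, ord, MvPolynomial.vars_neg]

end Degree

section Support

variable {ι D : Type*} [CommRing D] [Differential D] {s t : Set (ι × ℕ)}

theorem deriv_mem_supported (hst : s ⊆ t) (ht : ∀ v ∈ s, (v.1, v.2 + 1) ∈ t) {f : DiffPoly ι D}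
    (hf : f ∈ MvPolynomial.supported D s) : f′ ∈ MvPolynomial.supported D t := by
  have hle := MvPolynomial.supported_mono (R := D) hst
  induction hf using Algebra.adjoin_induction with
  | mem f hf =>
    obtain ⟨v, hv, rfl⟩ := hf
    exact deriv_X (D := D) v ▸ Algebra.subset_adjoin ⟨_, ht v hv, rfl⟩
  | algebraMap a =>
    rw [MvPolynomial.algebraMap_eq, deriv_C]
    exact Subalgebra.algebraMap_mem _ _
  | add f g _ _ hf hg =>
    rw [map_add]
    exact add_mem hf hg
  | mul f g hf hg ihf ihg =>
    rw [Derivation.leibniz]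
    exact add_mem (mul_mem (hle hf) ihg) (mul_mem (hle hg) ihf)

theorem coeffRow_deriv (N : ℕ) (f : DiffPoly Unit D) (c : Fin (N + 2)) :
    coeffRow N f′ c =
      (coeffRow N f c)′ + if h : (c : ℕ) < N then coeffRow N f ⟨c + 1, by lia⟩ else 0 := by
  simp only [coeffRow_apply, linPart_deriv, constantCoeff_deriv]
  rcases lt_trichotomy (c : ℕ) N with h | h | h
  · obtain ⟨k, hk⟩ : ∃ k, N - c = k + 1 := ⟨N - c - 1, by lia⟩
    rw [if_pos h.le, if_pos h.le, dif_pos h, if_pos (by lia), hk, coeff_succ_derivMul,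
      show N - (c + 1) = k by lia]
  · rw [if_pos h.le, if_pos h.le, dif_neg h.not_lt, h, Nat.sub_self, coeff_zero_derivMul, add_zero]
  · rw [if_neg h.not_ge, if_neg h.not_ge, dif_neg h.not_gt, add_zero]

theorem coeffRow_deriv_mem_supported (hst : s ⊆ t) (ht : ∀ v ∈ s, (v.1, v.2 + 1) ∈ t) {N : ℕ}
    {f : DiffPoly Unit (DiffPoly ι D)} (hf : ∀ c, coeffRow N f c ∈ MvPolynomial.supported D s)
    (c : Fin (N + 2)) : coeffRow N f′ c ∈ MvPolynomial.supported D t := by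
  rw [coeffRow_deriv]
  refine add_mem (deriv_mem_supported hst ht (hf c)) ?_
  split_ifs
  · exact MvPolynomial.supported_mono hst (hf _)
  · exact zero_mem _

end Support

section BaseChange

variable {ι D : Type*} [CommRing D]

/-- The inclusion of `D{u}` into the ring `D{y_i : i ∈ ι}{u}` in which `implicitEq` lives. -/
def baseChange (ι : Type*) {D : Type*} [CommRing D] :
    DiffPoly Unit D →+* DiffPoly Unit (DiffPoly ι D) :=
  MvPolynomial.map MvPolynomial.C

theorem totalDegree_baseChange_le (P : DiffPoly Unit D) :
    (baseChange ι P).totalDegree ≤ P.totalDegree :=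
  Finset.sup_mono (MvPolynomial.support_map_subset _ _)

theorem linPart_baseChange (P : DiffPoly Unit D) :
    linPart (baseChange ι P) = (linPart P).map MvPolynomial.C :=
  linPart_map _ P

theorem coeffRow_baseChange_mem_supported (N : ℕ) (P : DiffPoly Unit D) (s : Set (ι × ℕ))
    (c : Fin (N + 2)) : coeffRow N (baseChange ι P) c ∈ MvPolynomial.supported D s := by
  rw [baseChange, coeffRow_map]
  exact Subalgebra.algebraMap_mem _ _

theorem deriv_baseChange [Differential D] (P : DiffPoly Unit D) :
    (baseChange ι P)′ = baseChange ι (Differential.deriv P) :=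
  (map_deriv (fun a => (deriv_C a).symm) P).symm

end BaseChange

section ImplicitEq

variable {F : Type*} [Field F] {i : Fin 2} {P Q : DiffPoly Unit F}

theorem implicitEq_eq_smul_sub (i : Fin 2) (P Q : DiffPoly Unit F) :
    implicitEq i P Q =
      (MvPolynomial.X (i, 0) : DiffPoly (Fin 2) F) • baseChange (Fin 2) Q -
        baseChange (Fin 2) P := by
  rw [MvPolynomial.smul_eq_C_mul]
  rfl

theorem degree_smul_map_sub_map {A : Type*} [CommRing A] [Nontrivial A] {φ : F →+* A} {z : A}
    (hz : ∀ a b, z * φ b = φ a → b = 0) (p q : F[X]) :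
    (z • q.map φ - p.map φ).degree = max p.degree q.degree := by
  have coeff_eq_zero_iff (k : ℕ) :
      (z • q.map φ - p.map φ).coeff k = 0 ↔ p.coeff k = 0 ∧ q.coeff k = 0 := by
    rw [coeff_sub, coeff_smul, coeff_map, coeff_map, smul_eq_mul, sub_eq_zero]
    refine ⟨fun h => ?_, fun ⟨hp, hq⟩ => by rw [hp, hq, map_zero, mul_zero]⟩
    have hq := hz _ _ h
    rw [hq, map_zero, mul_zero, eq_comm, map_eq_zero] at h
    exact ⟨h, hq⟩
  refine eq_of_forall_ge_iff fun n => ?_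
  simp only [max_le_iff, degree_le_iff_coeff_zero, coeff_eq_zero_iff, forall_and]

theorem eq_zero_of_X_mul_C_eq_C {τ : Type*} (v : τ) (a b : F)
    (h : (MvPolynomial.X v * MvPolynomial.C b : MvPolynomial τ F) = MvPolynomial.C a) : b = 0 := by
  classical
  simpa [MvPolynomial.coeff_C, mul_comm (MvPolynomial.X v), MvPolynomial.coeff_C_mul,
    eq_comm (a := (0 : τ →₀ ℕ))] using congrArg (MvPolynomial.coeff (Finsupp.single v 1)) h

theorem totalDegree_implicitEq_le (hP : P.totalDegree ≤ 1) (hQ : Q.totalDegree ≤ 1) :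
    (implicitEq i P Q).totalDegree ≤ 1 := by
  rw [implicitEq_eq_smul_sub]
  exact (MvPolynomial.totalDegree_sub _ _).trans <| max_le
    ((MvPolynomial.totalDegree_smul_le _ _).trans ((totalDegree_baseChange_le Q).trans hQ))
    ((totalDegree_baseChange_le P).trans hP)

theorem ord_implicitEq (hP : P.totalDegree ≤ 1) (hQ : Q.totalDegree ≤ 1) :
    ord () (implicitEq i P Q) = fracOrd P Q := by
  rw [ord_eq_degree_linPart (totalDegree_implicitEq_le hP hQ), implicitEq_eq_smul_sub, map_sub,
    map_smul, linPart_baseChange, linPart_baseChange,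
    degree_smul_map_sub_map (eq_zero_of_X_mul_C_eq_C _), fracOrd, ord_eq_degree_linPart hP,
    ord_eq_degree_linPart hQ]

theorem exists_iterDeriv_implicitEq_eq_smul_add [Differential F] (i : Fin 2)
    (P Q : DiffPoly Unit F) (j : ℕ) :
    ∃ r, iterDeriv j (implicitEq i P Q) =
        (MvPolynomial.X (i, j) : DiffPoly (Fin 2) F) • baseChange (Fin 2) Q + r ∧
      ∀ N c, coeffRow N r c ∈ MvPolynomial.supported F {v : Fin 2 × ℕ | v.1 = i ∧ v.2 < j} := by
  induction j with
  | zero =>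
    refine ⟨-baseChange (Fin 2) P, ?_, fun N c => ?_⟩
    · rw [← sub_eq_add_neg]
      exact implicitEq_eq_smul_sub i P Q
    · rw [map_neg]
      exact neg_mem (coeffRow_baseChange_mem_supported N P _ c)
  | succ j ih =>
    obtain ⟨r, hr, hr_mem⟩ := ih
    refine ⟨(MvPolynomial.X (i, j) : DiffPoly (Fin 2) F) • baseChange (Fin 2) Q′ + r′, ?_,
      fun N c => ?_⟩
    · rw [iterDeriv_succ, hr]
      simp only [MvPolynomial.smul_eq_C_mul, map_add, Derivation.leibniz, deriv_C, deriv_X,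
        deriv_baseChange, smul_eq_mul]
      ring
    · rw [map_add, map_smul]
      refine add_mem (mul_mem ?_ (coeffRow_baseChange_mem_supported N _ _ c))
        (coeffRow_deriv_mem_supported ?_ ?_ (hr_mem N) c)
      · exact Algebra.subset_adjoin ⟨_, ⟨rfl, j.lt_succ_self⟩, rfl⟩
      · exact fun v hv => ⟨hv.1, hv.2.trans j.lt_succ_self⟩
      · exact fun v hv => ⟨hv.1, Nat.succ_lt_succ hv.2⟩

theorem coeffRow_iterDeriv_implicitEq_mem_supported [Differential F] {s : Set (Fin 2 × ℕ)} {j : ℕ}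
    (hs : ∀ k ≤ j, (i, k) ∈ s) (P Q : DiffPoly Unit F) (N : ℕ) (c : Fin (N + 2)) :
    coeffRow N (iterDeriv j (implicitEq i P Q)) c ∈ MvPolynomial.supported F s := by
  obtain ⟨r, hr, hr_mem⟩ := exists_iterDeriv_implicitEq_eq_smul_add i P Q j
  rw [hr, map_add, map_smul]
  refine add_mem (mul_mem (Algebra.subset_adjoin ⟨_, hs j le_rfl, rfl⟩)
    (coeffRow_baseChange_mem_supported N Q s c)) (MvPolynomial.supported_mono ?_ (hr_mem N c))
  rintro ⟨_, k⟩ ⟨rfl, hk⟩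
  exact hs k hk.le

theorem degreeOf_and_ord_det_diffResultantMatrix_implicitEq [Differential F] {i j : Fin 2}
    (hij : i ≠ j) {m n : ℕ} {P₁ Q₁ P₂ Q₂ : DiffPoly Unit F}
    (hdet : ((diffResultantMatrix m n (implicitEq i P₁ Q₁) (implicitEq j P₂ Q₂)).updateRow 0
      (coeffRow (m + n) (baseChange (Fin 2) Q₁))).det ≠ 0) :
    (diffResultantMatrix m n (implicitEq i P₁ Q₁) (implicitEq j P₂ Q₂)).det.degreeOf (i, n) = 1 ∧
      ord i (diffResultantMatrix m n (implicitEq i P₁ Q₁) (implicitEq j P₂ Q₂)).det = n := by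
  let s : Set (Fin 2 × ℕ) := {v | v.1 = i → v.2 < n}
  obtain ⟨r, hr, hr_mem⟩ := exists_iterDeriv_implicitEq_eq_smul_add i P₁ Q₁ n
  have hrow₀ : diffResultantMatrix m n (implicitEq i P₁ Q₁) (implicitEq j P₂ Q₂) 0 =
      (MvPolynomial.X (i, n) : DiffPoly (Fin 2) F) • coeffRow (m + n) (baseChange (Fin 2) Q₁) +
        coeffRow (m + n) r := by
    rw [← map_smul, ← map_add, ← hr]
    exact diffResultantMatrix_apply ..
  have hrows (k : Fin (m + n + 2)) (hk : k ≠ 0) (c : Fin (m + n + 2)) :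
      diffResultantMatrix m n (implicitEq i P₁ Q₁) (implicitEq j P₂ Q₂) k c ∈
        MvPolynomial.supported F s := by
    rw [diffResultantMatrix_apply, prolongation]
    split_ifs
    · refine coeffRow_iterDeriv_implicitEq_mem_supported (s := s) (fun _ hl _ => ?_) P₁ Q₁ _ c
      exact hl.trans_lt (by have := Fin.val_ne_zero_iff.mpr hk; lia)
    · exact coeffRow_iterDeriv_implicitEq_mem_supported (s := s)
        (fun _ _ hji => (hij hji.symm).elim) P₂ Q₂ _ c
  obtain ⟨hdeg, hmem⟩ := degreeOf_det_and_mem_supported (s := s) (fun h => lt_irrefl n (h rfl))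
    hrow₀ (coeffRow_baseChange_mem_supported _ Q₁ s)
    (fun c => MvPolynomial.supported_mono (fun v hv _ => hv.2) (hr_mem _ c)) hrows hdet
  exact ⟨hdeg, ord_eq_of_degreeOf (hdeg ▸ one_ne_zero) hmem⟩

end ImplicitEq

section Specialization

variable {F E : Type*} [Field F] [Field E] [Algebra F E] {P Q : DiffPoly Unit F} {z : E}

/-- The specialization of `implicitEq` at a point with coordinate `z`: the polynomial
`z Q(u) - P(u)` in `E{u}`. -/
def implicitEqAt (z : E) (P Q : DiffPoly Unit F) : DiffPoly Unit E :=
  z • Q.map (algebraMap F E) - P.map (algebraMap F E)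

theorem degree_linPart_implicitEqAt (hP : P.totalDegree ≤ 1) (hQ : Q.totalDegree ≤ 1)
    (hz : z ∉ (algebraMap F E).range) : (linPart (implicitEqAt z P Q)).degree = fracOrd P Q := by
  rw [implicitEqAt, map_sub, map_smul, linPart_map, linPart_map, degree_smul_map_sub_map, fracOrd,
    ord_eq_degree_linPart hP, ord_eq_degree_linPart hQ]
  intro a b hab
  by_contra hb
  exact hz ⟨a / b, by rw [map_div₀, ← hab, mul_div_cancel_right₀ _ (by simpa using hb)]⟩

variable [Differential E] {u : E}

theorem linPart_implicitEqAt (u : E) (hP : P.totalDegree ≤ 1) (hQ : Q.totalDegree ≤ 1) (z : E) :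
    linPart (implicitEqAt z P Q) = z • differentialAt u Q - differentialAt u P := by
  rw [implicitEqAt, map_sub, map_smul, linPart_map, linPart_map, differentialAt_eq_map_linPart u hP,
    differentialAt_eq_map_linPart u hQ]

theorem affineValue_implicitEqAt (hP : P.totalDegree ≤ 1) (hQ : Q.totalDegree ≤ 1)
    (hQu : diffEval u Q ≠ 0) :
    affineValue u (implicitEqAt (diffEval u P / diffEval u Q) P Q) = 0 := by
  rw [implicitEqAt, map_sub, map_smul, affineValue_map hP, affineValue_map hQ]
  exact sub_eq_zero.mpr (div_mul_cancel₀ _ hQu)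

theorem map_specialize_baseChange {ι : Type*} (ζ : ι → E) (P : DiffPoly Unit F) :
    (baseChange ι P).map (specialize ζ : DiffPoly ι F →ₐ[F] E).toRingHom =
      P.map (algebraMap F E) := by
  rw [baseChange, MvPolynomial.map_map]
  congr 2
  exact RingHom.ext (specialize_C ζ)

theorem map_specialize_implicitEq (ζ : Fin 2 → E) (i : Fin 2) (P Q : DiffPoly Unit F) :
    (implicitEq i P Q).map (specialize ζ : DiffPoly (Fin 2) F →ₐ[F] E).toRingHom =
      implicitEqAt (ζ i) P Q := by
  rw [implicitEq_eq_smul_sub, MvPolynomial.smul_eq_C_mul, map_sub, map_mul, MvPolynomial.map_C,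
    map_specialize_baseChange, map_specialize_baseChange, ← MvPolynomial.smul_eq_C_mul]
  exact congr(($(specialize_X ζ (i, 0)) : E) • _ - _)

theorem diffEval_ne_zero (hu : IsDiffTranscendental F u) (hQ : Q ≠ 0) : diffEval u Q ≠ 0 :=
  (map_ne_zero_iff _ (specialize_injective hu)).mpr hQ

theorem diffEval_div_notMem_range (hu : IsDiffTranscendental F u) (hQ : Q ≠ 0)
    (hPQ : IsRelPrime P Q) {m : ℕ} (hm : fracOrd P Q = m) :
    diffEval u P / diffEval u Q ∉ (algebraMap F E).range := by
  rintro ⟨c, hc⟩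
  have hP : P = MvPolynomial.C c * Q := specialize_injective hu <| by
    rw [map_mul, specialize_C, hc]
    exact (div_mul_cancel₀ _ (diffEval_ne_zero hu hQ)).symm
  have hunit : IsUnit Q := hPQ (hP ▸ dvd_mul_left _ _) dvd_rfl
  obtain ⟨b, -, rfl⟩ := MvPolynomial.isUnit_iff_eq_C_of_isReduced.mp hunit
  rw [hP, ← MvPolynomial.C_mul, fracOrd, ord, ord, MvPolynomial.vars_C, MvPolynomial.vars_C] at hm
  simp at hm

end Specialization

section Parametrization

variable {F E : Type*} [Field F] [Field E] [Differential E] [Algebra F E]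
  {u : E} {P₁ Q₁ P₂ Q₂ : DiffPoly Unit F}

theorem IsLinearDiffRatParam.symm (h : IsLinearDiffRatParam u P₁ Q₁ P₂ Q₂) :
    IsLinearDiffRatParam u P₂ Q₂ P₁ Q₁ where
  denom_ne_zero₁ := h.denom_ne_zero₂
  denom_ne_zero₂ := h.denom_ne_zero₁
  degree_num₁ := h.degree_num₂
  degree_denom₁ := h.degree_denom₂
  degree_num₂ := h.degree_num₁
  degree_denom₂ := h.degree_denom₁
  reduced₁ := h.reduced₂
  reduced₂ := h.reduced₁
  not_both_const := fun hc => h.not_both_const hc.symm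

theorem IsProperParam.symm (h : IsProperParam u P₁ Q₁ P₂ Q₂) : IsProperParam u P₂ Q₂ P₁ Q₁ := by
  rwa [IsProperParam, Set.pair_comm]

variable [Differential F] [DifferentialAlgebra F E] {m₁ m₂ : ℕ} {i j : Fin 2}

theorem det_updateRow_diffResultantMatrix_implicitEqAt_ne_zero (hu : IsDiffTranscendental F u)
    (hparam : IsLinearDiffRatParam u P₁ Q₁ P₂ Q₂) (hm₁ : fracOrd P₁ Q₁ = m₁)
    (hm₂ : fracOrd P₂ Q₂ = m₂) (hproper : IsProperParam u P₁ Q₁ P₂ Q₂) :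
    ((diffResultantMatrix m₁ m₂ (implicitEqAt (diffEval u P₁ / diffEval u Q₁) P₁ Q₁)
      (implicitEqAt (diffEval u P₂ / diffEval u Q₂) P₂ Q₂)).updateRow 0
        (coeffRow (m₁ + m₂) (Q₁.map (algebraMap F E)))).det ≠ 0 := by
  have ⟨hQ₁, hQ₂, hP₁d, hQ₁d, hP₂d, hQ₂d, hred₁, hred₂, _⟩ := hparam
  have hQ₁u := diffEval_ne_zero hu hQ₁
  have hQ₂u := diffEval_ne_zero hu hQ₂
  have hdeg₁ := hm₁ ▸ degree_linPart_implicitEqAt hP₁d hQ₁d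
    (diffEval_div_notMem_range hu hQ₁ hred₁ hm₁)
  have hdeg₂ := hm₂ ▸ degree_linPart_implicitEqAt hP₂d hQ₂d
    (diffEval_div_notMem_range hu hQ₂ hred₂ hm₂)
  have hdegQ₁ : (linPart (Q₁.map (algebraMap F E))).degree ≤ m₁ := by
    rw [linPart_map, degree_map, ← ord_eq_degree_linPart hQ₁d, ← hm₁]
    exact le_max_right _ _
  have hgen := generatesUnitIdeal_of_isProperParam hu hproper hQ₁u hQ₂u
  rw [← linPart_implicitEqAt u hP₁d hQ₁d, ← linPart_implicitEqAt u hP₂d hQ₂d] at hgen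
  exact hgen.det_updateRow_diffResultantMatrix_ne_zero hdeg₁.le hdeg₂
    (affineValue_implicitEqAt hP₁d hQ₁d hQ₁u) (affineValue_implicitEqAt hP₂d hQ₂d hQ₂u)
    hdegQ₁ (by rwa [affineValue_map hQ₁d])

theorem det_updateRow_diffResultantMatrix_implicitEq_ne_zero (hu : IsDiffTranscendental F u)
    (hparam : IsLinearDiffRatParam u P₁ Q₁ P₂ Q₂) (hm₁ : fracOrd P₁ Q₁ = m₁)
    (hm₂ : fracOrd P₂ Q₂ = m₂) (hproper : IsProperParam u P₁ Q₁ P₂ Q₂) (hij : i ≠ j) :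
    ((diffResultantMatrix m₁ m₂ (implicitEq i P₁ Q₁) (implicitEq j P₂ Q₂)).updateRow 0
      (coeffRow (m₁ + m₂) (baseChange (Fin 2) Q₁))).det ≠ 0 := by
  let ζ : Fin 2 → E := fun k =>
    if k = i then diffEval u P₁ / diffEval u Q₁ else diffEval u P₂ / diffEval u Q₂
  let σ := (specialize ζ : DiffPoly (Fin 2) F →ₐ[F] E).toRingHom
  have hrow : ⇑σ ∘ coeffRow (m₁ + m₂) (baseChange (Fin 2) Q₁) =
      coeffRow (m₁ + m₂) (Q₁.map (algebraMap F E)) := by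
    rw [← map_specialize_baseChange ζ]
    exact funext fun c => (coeffRow_map σ _ _ c).symm
  refine ne_zero_of_map (f := σ) ?_
  rw [RingHom.map_det, RingHom.mapMatrix_apply, Matrix.map_updateRow, hrow,
    ← diffResultantMatrix_map (specialize_deriv ζ), map_specialize_implicitEq,
    map_specialize_implicitEq, show ζ i = _ from if_pos rfl, show ζ j = _ from if_neg hij.symm]
  exact det_updateRow_diffResultantMatrix_implicitEqAt_ne_zero hu hparam hm₁ hm₂ hproper

theorem degreeOf_and_ord_diffResultant_implicitEq (hu : IsDiffTranscendental F u)
    (hparam : IsLinearDiffRatParam u P₁ Q₁ P₂ Q₂) (hm₁ : fracOrd P₁ Q₁ = m₁)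
    (hm₂ : fracOrd P₂ Q₂ = m₂) (hproper : IsProperParam u P₁ Q₁ P₂ Q₂) (hij : i ≠ j) :
    (diffResultant (implicitEq i P₁ Q₁) (implicitEq j P₂ Q₂)).degreeOf (i, m₂) = 1 ∧
      ord i (diffResultant (implicitEq i P₁ Q₁) (implicitEq j P₂ Q₂)) = m₂ := by
  rw [diffResultant, ord_implicitEq hparam.degree_num₁ hparam.degree_denom₁, hm₁,
    ord_implicitEq hparam.degree_num₂ hparam.degree_denom₂, hm₂]
  exact degreeOf_and_ord_det_diffResultantMatrix_implicitEq hij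
    (det_updateRow_diffResultantMatrix_implicitEq_ne_zero hu hparam hm₁ hm₂ hproper hij)

end Parametrization

end DiffAlg

end

theorem mainTheorem5_general {F E : Type*} [Field F] [Differential F]
    [Field E] [Differential E] [Algebra F E] [DifferentialAlgebra F E]
    (u : E) (hu : DiffAlg.IsDiffTranscendental F u)
    (P₁ Q₁ P₂ Q₂ : DiffAlg.DiffPoly Unit F)
    (hparam : DiffAlg.IsLinearDiffRatParam u P₁ Q₁ P₂ Q₂)
    (m₁ m₂ : ℕ)
    (hm₁ : DiffAlg.fracOrd P₁ Q₁ = (m₁ : WithBot ℕ))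
    (hm₂ : DiffAlg.fracOrd P₂ Q₂ = (m₂ : WithBot ℕ))
    (hproper : DiffAlg.IsProperParam u P₁ Q₁ P₂ Q₂)
    (R : DiffAlg.DiffPoly (Fin 2) F)
    (hR : R = DiffAlg.diffResultant
      (DiffAlg.implicitEq 0 P₁ Q₁) (DiffAlg.implicitEq 1 P₂ Q₂)) :
    R ≠ 0 ∧
      DiffAlg.ord 0 R = (m₂ : WithBot ℕ) ∧
      DiffAlg.ord 1 R = (m₁ : WithBot ℕ) ∧
      R.degreeOf (0, m₂) = 1 ∧
      R.degreeOf (1, m₁) = 1 := by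
  subst hR
  obtain ⟨hdeg₀, hord₀⟩ := DiffAlg.degreeOf_and_ord_diffResultant_implicitEq hu hparam hm₁ hm₂
    hproper (i := 0) (j := 1) (by decide)
  obtain ⟨hdeg₁, hord₁⟩ := DiffAlg.degreeOf_and_ord_diffResultant_implicitEq hu hparam.symm hm₂ hm₁
    hproper.symm (i := 1) (j := 0) (by decide)
  have hne := MvPolynomial.ne_zero_of_degreeOf_ne_zero (hdeg₀ ▸ one_ne_zero)
  rcases DiffAlg.diffResultant_swap (DiffAlg.implicitEq 0 P₁ Q₁) (DiffAlg.implicitEq 1 P₂ Q₂) with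
    hswap | hswap
  · rw [hswap] at hdeg₁ hord₁
    exact ⟨hne, hord₀, hord₁, hdeg₀, hdeg₁⟩
  · rw [hswap, MvPolynomial.degreeOf_neg] at hdeg₁
    rw [hswap, DiffAlg.ord_neg] at hord₁
    exact ⟨hne, hord₀, hord₁, hdeg₀, hdeg₁⟩

theorem mainTheorem5 {F E : Type*} [Field F] [CharZero F] [Differential F]
    [Field E] [Differential E] [Algebra F E] [DifferentialAlgebra F E]
    (u : E) (hu : DiffAlg.IsDiffTranscendental F u)
    (P₁ Q₁ P₂ Q₂ : DiffAlg.DiffPoly Unit F)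
    (hparam : DiffAlg.IsLinearDiffRatParam u P₁ Q₁ P₂ Q₂)
    (m₁ m₂ : ℕ)
    (hm₁ : DiffAlg.fracOrd P₁ Q₁ = (m₁ : WithBot ℕ))
    (hm₂ : DiffAlg.fracOrd P₂ Q₂ = (m₂ : WithBot ℕ))
    (hproper : DiffAlg.IsProperParam u P₁ Q₁ P₂ Q₂)
    (R : DiffAlg.DiffPoly (Fin 2) F)
    (hR : R = DiffAlg.diffResultant
      (DiffAlg.implicitEq 0 P₁ Q₁) (DiffAlg.implicitEq 1 P₂ Q₂)) :
    R ≠ 0 ∧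
      DiffAlg.ord 0 R = (m₂ : WithBot ℕ) ∧
      DiffAlg.ord 1 R = (m₁ : WithBot ℕ) ∧
      R.degreeOf (0, m₂) = 1 ∧
      R.degreeOf (1, m₁) = 1 :=
  mainTheorem5_general u hu P₁ Q₁ P₂ Q₂ hparam m₁ m₂ hm₁ hm₂ hproper R hR
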